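/- Let $K$ be a commutative ring with unit. A representation $(V,G)$ over $K$ is a group $G$ together with a right $KG$-module $V$. A homomorphism $(\alpha,\beta):(V,G)\to(W,H)$ is a $K$-linear map $\alpha:V\to W$ together with a group homomorphism $\beta:G\to H$ such that $(v\circ g)^{\alpha}=v^{\alpha}\circ g^{\beta}$ for all $v\in V$, $g\in G$. For finite sets $X$, $Y$ let $W(X,Y)=(XKF(Y),F(Y))$, where $F(Y)$ is the free group on $Y$ and $XKF(Y)$ is the free right $KF(Y)$-module with basis $X$. An action type quasi-identity is a formula $$(w_1=0\wedge\dots\wedge w_n=0)\Rightarrow(w_0=0),\qquad w_0,\dots,w_n\in XKF(Y),$$ with $X$, $Y$ finite subsets of fixed countably infinite sets of variables; $(V,G)$ satisfies it if $w_0^{\alpha}=0$ for every homomorphism $(\alpha,\beta):W(X,Y)\to(V,G)$ with $w_1^{\alpha}=\dots=w_n^{\alpha}=0$. For a class $\mathfrak X$ of representations over $K$, let $qVar_{a.t.}\mathfrak X$ be the class of all representations over $K$ that satisfy every action type quasi-identity satisfied by all members of $\mathfrak X$. Define the following operators on classes of representations over $K$ (the first three up to isomorphism of representations): - $\mathcal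 S\mathfrak X$: subrepresentations $(V_0,G_0)$ of members $(V,G)$ of $\mathfrak X$, where $V_0\le V$ is a $K$-submodule, $G_0\le G$ is a subgroup and $V_0$ is stable under $G_0$; - $\mathcal C\mathfrak X$: Cartesian products $\left(\prod_{i\in I}V_i,\prod_{i\in I}G_i\right)$, with componentwise action, of families of members of $\mathfrak X$ (the empty family is allowed); - $\mathcal C_{up}\mathfrak X$: ultraproducts of families of members of $\mathfrak X$, i.e. the quotients of $\left(\prod_{i\in I}V_i,\prod_{i\in I}G_i\right)$ by equality on a set of an ultrafilter on $I$, in both components; - $\mathcal Q^{r}\mathfrak X$: representations $(V,G)$ for which there are $(V,D)\in\mathfrak X$ and an epimorphism of groups $\varphi:D\to G$ such that $(id_V,\varphi):(V,D)\to(V,G)$ is a homomorphism; - $\mathcal Q^{0}\mathfrak X$: representations $(V,G)$ for which there are $(V,D)\in\mathfrak X$ and an epimorphism of groups $\varphi:G\to D$ such that $(id_V,\varphi):(V,G)\to(V,D)$ is a homomorphism. Then, for every class $\mathfrak X$ of representations over $K$, $$qVar_{a.t.}\mathfrak X=\mathcal Q^{0}\mathcal Q^{r}\mathcal S\mathcal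 C\mathcal C_{up}\mathfrak X.$$ -/

import Mathlib

universe u v w v' w'

/-- A representation `(V, G)` of a group over `K`: a `K`-module `V`, a group `G` and a `K`-linear
right action of `G` on `V`, i.e. a `K`-linear representation of the opposite group. -/
structure GroupRep (K : Type u) [CommRing K] where
  V : Type v
  G : Type w
  [addCommGroupV : AddCommGroup V]
  [moduleV : Module K V]
  [groupG : Group G]
  ρ : Representation K Gᵐᵒᵖ V

namespace GroupRep

attribute [instance] addCommGroupV moduleV groupG

variable {K : Type u} [CommRing K]

/-- The right action `v ∘ g`. -/
def act (R : GroupRep.{u, v, w} K) (x : R.V) (g : R.G) : R.V := R.ρ (MulOpposite.op g) x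

theorem act_one (R : GroupRep.{u, v, w} K) (x : R.V) : R.act x 1 = x := by
  simp [act]

theorem act_mul (R : GroupRep.{u, v, w} K) (x : R.V) (g h : R.G) :
    R.act x (g * h) = R.act (R.act x g) h := by
  simp [act]

theorem act_add (R : GroupRep.{u, v, w} K) (x y : R.V) (g : R.G) :
    R.act (x + y) g = R.act x g + R.act y g := by
  simp [act]

theorem act_smul (R : GroupRep.{u, v, w} K) (k : K) (x : R.V) (g : R.G) :
    R.act (k • x) g = k • R.act x g := by
  simp [act]

theorem act_sub (R : GroupRep.{u, v, w} K) (x y : R.V) (g : R.G) :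
    R.act (x - y) g = R.act x g - R.act y g := by
  simp [act]

/-- A representation from the data and the laws of a linear right action. -/
def ofRightAction (V : Type v) (G : Type w) [AddCommGroup V] [Module K V] [Group G]
    (a : V → G → V) (a_add : ∀ x y g, a (x + y) g = a x g + a y g)
    (a_smul : ∀ (k : K) x g, a (k • x) g = k • a x g)
    (a_one : ∀ x, a x 1 = x) (a_mul : ∀ x g h, a x (g * h) = a (a x g) h) :
    GroupRep.{u, v, w} K where
  V := V
  G := G
  ρ :=
    { toFun := fun g =>
        { toFun := fun x => a x g.unop
          map_add' := fun x y => a_add x y g.unop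
          map_smul' := fun k x => a_smul k x g.unop }
      map_one' := LinearMap.ext fun x => a_one x
      map_mul' := fun g h => LinearMap.ext fun x => a_mul x h.unop g.unop }

/-- A homomorphism `(α, β) : (V, G) → (W, H)` of representations. -/
structure Hom (R : GroupRep.{u, v, w} K) (S : GroupRep.{u, v', w'} K) where
  α : R.V →ₗ[K] S.V
  β : R.G →* S.G
  map_act : ∀ (x : R.V) (g : R.G), α (R.act x g) = S.act (α x) (β g)

/-- Isomorphism of representations. -/
def Isomorphic (R : GroupRep.{u, v, w} K) (S : GroupRep.{u, v', w'} K) : Prop :=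
  ∃ f : Hom R S, Function.Bijective f.α ∧ Function.Bijective f.β

/-- A subrepresentation `(V₀, G₀) ≤ (V, G)`. -/
structure Subrep (R : GroupRep.{u, v, w} K) where
  V₀ : Submodule K R.V
  G₀ : Subgroup R.G
  act_mem : ∀ x ∈ V₀, ∀ g ∈ G₀, R.act x g ∈ V₀

/-- A subrepresentation, regarded as a representation. -/
def Subrep.toGroupRep {R : GroupRep.{u, v, w} K} (P : Subrep R) : GroupRep.{u, v, w} K :=
  ofRightAction P.V₀ P.G₀ (fun x g => ⟨R.act x g, P.act_mem x x.2 g g.2⟩)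
    (fun x y g => Subtype.ext (R.act_add x y g))
    (fun k x g => Subtype.ext (R.act_smul k x g))
    (fun x => Subtype.ext (R.act_one x))
    (fun x g h => Subtype.ext (R.act_mul x g h))

/-- The Cartesian product of a family of representations, with componentwise action. -/
def cartesianProduct {I : Type u} (P : I → GroupRep.{u, v, w} K) :
    GroupRep.{u, max u v, max u w} K :=
  ofRightAction (∀ i, (P i).V) (∀ i, (P i).G) (fun x g i => (P i).act (x i) (g i))
    (fun x y g => funext fun i => (P i).act_add (x i) (y i) (g i))
    (fun k x g => funext fun i => (P i).act_smul k (x i) (g i))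
    (fun x => funext fun i => (P i).act_one (x i))
    (fun x g h => funext fun i => (P i).act_mul (x i) (g i) (h i))

section Filtered

variable {I : Type u} (F : Filter I) (P : I → GroupRep.{u, v, w} K)

/-- The elements of the product module that are zero on a set of the filter. -/
def filterSubmodule : Submodule K (∀ i, (P i).V) where
  carrier := {x | {i | x i = 0} ∈ F}
  zero_mem' := by simp
  add_mem' := by
    intro x y hx hy
    filter_upwards [hx, hy] with i hi hj
    have h1 : x i = 0 := hi
    have h2 : y i = 0 := hj
    simp [h1, h2]
  smul_mem' := by
    intro k x hx
    filter_upwards [hx] with i hi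
    have h1 : x i = 0 := hi
    simp [h1]

/-- The elements of the product group that are one on a set of the filter. -/
def filterSubgroup : Subgroup (∀ i, (P i).G) where
  carrier := {g | {i | g i = 1} ∈ F}
  one_mem' := by simp
  mul_mem' := by
    intro g h hg hh
    filter_upwards [hg, hh] with i hi hj
    have h1 : g i = 1 := hi
    have h2 : h i = 1 := hj
    simp [h1, h2]
  inv_mem' := by
    intro g hg
    filter_upwards [hg] with i hi
    have h1 : g i = 1 := hi
    simp [h1]

instance filterSubgroup_normal : (filterSubgroup F P).Normal where
  conj_mem := by
    intro g hg h
    change {i | (h * g * h⁻¹) i = 1} ∈ F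
    filter_upwards [show {i | g i = 1} ∈ F from hg] with i hi
    have h1 : g i = 1 := hi
    simp [h1]

/-- The quotient by `filterSubmodule` is the quotient by the equivalence
`x ∼ y ↔ {i | x i = y i} ∈ F`. -/
theorem mk_filterSubmodule_eq_iff (x y : ∀ i, (P i).V) :
    (Submodule.Quotient.mk x : (∀ i, (P i).V) ⧸ filterSubmodule F P) = Submodule.Quotient.mk y ↔
      {i | x i = y i} ∈ F := by
  rw [Submodule.Quotient.eq]
  change {i | (x - y) i = 0} ∈ F ↔ _
  simp [sub_eq_zero]

/-- The quotient by `filterSubgroup` is the quotient by the equivalence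
`g ∼ h ↔ {i | g i = h i} ∈ F`. -/
theorem mk_filterSubgroup_eq_iff (g h : ∀ i, (P i).G) :
    (QuotientGroup.mk g : (∀ i, (P i).G) ⧸ filterSubgroup F P) = QuotientGroup.mk h ↔
      {i | g i = h i} ∈ F := by
  rw [QuotientGroup.eq]
  change {i | (g⁻¹ * h) i = 1} ∈ F ↔ _
  simp [inv_mul_eq_one]

/-- The action on classes: `[x] ∘ [g] = [x ∘ g]`. -/
def filterAct (x : (∀ i, (P i).V) ⧸ filterSubmodule F P)
    (g : (∀ i, (P i).G) ⧸ filterSubgroup F P) : (∀ i, (P i).V) ⧸ filterSubmodule F P :=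
  Quotient.liftOn₂' x g
    (fun x g => Submodule.Quotient.mk fun i => (P i).act (x i) (g i))
    (by
      intro x g y h hxy hgh
      have h1 : {i | x i = y i} ∈ F := (mk_filterSubmodule_eq_iff F P x y).1 (Quotient.sound' hxy)
      have h2 : {i | g i = h i} ∈ F := (mk_filterSubgroup_eq_iff F P g h).1 (Quotient.sound' hgh)
      refine (mk_filterSubmodule_eq_iff F P _ _).2 ?_
      filter_upwards [h1, h2] with i hi hj
      have e1 : x i = y i := hi
      have e2 : g i = h i := hj
      simp [e1, e2])

/-- The filtered product of a family of representations by the filter `F`. -/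
def filteredProduct : GroupRep.{u, max u v, max u w} K :=
  ofRightAction ((∀ i, (P i).V) ⧸ filterSubmodule F P) ((∀ i, (P i).G) ⧸ filterSubgroup F P)
    (filterAct F P)
    (by
      rintro ⟨x⟩ ⟨y⟩ ⟨g⟩
      exact congrArg Submodule.Quotient.mk (funext fun i => (P i).act_add (x i) (y i) (g i)))
    (by
      rintro k ⟨x⟩ ⟨g⟩
      exact congrArg Submodule.Quotient.mk (funext fun i => (P i).act_smul k (x i) (g i)))
    (by
      rintro ⟨x⟩
      exact congrArg Submodule.Quotient.mk (funext fun i => (P i).act_one (x i)))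
    (by
      rintro ⟨x⟩ ⟨g⟩ ⟨h⟩
      exact congrArg Submodule.Quotient.mk (funext fun i => (P i).act_mul (x i) (g i) (h i)))

end Filtered

/-- The free representation `W(X, Y) = (XKF(Y), F(Y))`: the free right `KF(Y)`-module with basis
`X`, on which `F(Y)` acts by right multiplication. -/
noncomputable def free (K : Type u) [CommRing K] (X : Type v) (Y : Type w) :
    GroupRep.{u, max u v w, w} K :=
  ofRightAction (X →₀ MonoidAlgebra K (FreeGroup Y)) (FreeGroup Y)
    (fun a g => a.mapRange (fun r => r * MonoidAlgebra.of K (FreeGroup Y) g) (zero_mul _))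
    (fun a b g => by ext1 x; simp [add_mul])
    (fun k a g => by ext1 x; simp)
    (fun a => by ext1 x; rw [Finsupp.mapRange_apply, map_one, mul_one])
    (fun a g h => by
      ext1 x
      simp only [Finsupp.mapRange_apply, map_mul, mul_assoc])

end GroupRep

/-- An action type quasi-identity `(w₁ = 0 ∧ … ∧ wₙ = 0) ⇒ (w₀ = 0)`, where the `wᵢ` are elements
of `XKF(Y)` for finite sets `X`, `Y` of variables taken from two countable stocks. -/
structure ActionQuasiIdentity (K : Type u) [CommRing K] where
  X : Finset ℕ
  Y : Finset ℕ
  n : ℕ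
  premise : Fin n → (GroupRep.free K X Y).V
  conclusion : (GroupRep.free K X Y).V

namespace GroupRep

variable {K : Type u} [CommRing K]

/-- `(V, G)` satisfies the action type quasi-identity `q`. -/
def Satisfies (R : GroupRep.{u, v, w} K) (q : ActionQuasiIdentity K) : Prop :=
  ∀ f : Hom (free K q.X q.Y) R, (∀ i, f.α (q.premise i) = 0) → f.α q.conclusion = 0

/-- The action type quasi-identities satisfied by all representations of the class `𝔛`. -/
def qIdAT (𝔛 : Set (GroupRep.{u, u, u} K)) : Set (ActionQuasiIdentity K) :=
  {q | ∀ R ∈ 𝔛, R.Satisfies q}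

/-- The class of all representations satisfying a set of action type quasi-identities. -/
def qVar (Q : Set (ActionQuasiIdentity K)) : Set (GroupRep.{u, u, u} K) :=
  {R | ∀ q ∈ Q, R.Satisfies q}

/-- The action type quasi-variety generated by the class `𝔛`. -/
def qVarAT (𝔛 : Set (GroupRep.{u, u, u} K)) : Set (GroupRep.{u, u, u} K) :=
  qVar (qIdAT 𝔛)

/-- The operator `𝒮`: subrepresentations. -/
def opS (𝔛 : Set (GroupRep.{u, u, u} K)) : Set (GroupRep.{u, u, u} K) :=
  {R | ∃ P ∈ 𝔛, ∃ P₀ : Subrep P, Isomorphic R P₀.toGroupRep}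

/-- The operator `𝒞`: Cartesian products of families (the empty family included). -/
def opC (𝔛 : Set (GroupRep.{u, u, u} K)) : Set (GroupRep.{u, u, u} K) :=
  {R | ∃ (I : Type u) (P : I → GroupRep.{u, u, u} K),
    (∀ i, P i ∈ 𝔛) ∧ Isomorphic R (cartesianProduct P)}

/-- The operator `𝒞_up`: filtered products by ultrafilters. -/
def opCup (𝔛 : Set (GroupRep.{u, u, u} K)) : Set (GroupRep.{u, u, u} K) :=
  {R | ∃ (I : Type u) (U : Ultrafilter I) (P : I → GroupRep.{u, u, u} K),
    (∀ i, P i ∈ 𝔛) ∧ Isomorphic R (filteredProduct (U : Filter I) P)}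

/-- The operator `𝒬ʳ`: `(V, G)` such that some `(V, D) ∈ 𝔛` has an epimorphism `φ : D → G` for
which `(id_V, φ) : (V, D) → (V, G)` is a homomorphism. -/
def opQr (𝔛 : Set (GroupRep.{u, u, u} K)) : Set (GroupRep.{u, u, u} K) :=
  {R | ∃ (D : Type u) (_ : Group D) (τ : Representation K Dᵐᵒᵖ R.V),
    (⟨R.V, D, τ⟩ : GroupRep.{u, u, u} K) ∈ 𝔛 ∧
      ∃ f : Hom (⟨R.V, D, τ⟩ : GroupRep.{u, u, u} K) R,
        f.α = LinearMap.id ∧ Function.Surjective f.β}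

/-- The operator `𝒬⁰`: `(V, G)` such that some `(V, D) ∈ 𝔛` has an epimorphism `φ : G → D` for
which `(id_V, φ) : (V, G) → (V, D)` is a homomorphism. -/
def opQ0 (𝔛 : Set (GroupRep.{u, u, u} K)) : Set (GroupRep.{u, u, u} K) :=
  {R | ∃ (D : Type u) (_ : Group D) (τ : Representation K Dᵐᵒᵖ R.V),
    (⟨R.V, D, τ⟩ : GroupRep.{u, u, u} K) ∈ 𝔛 ∧
      ∃ f : Hom R (⟨R.V, D, τ⟩ : GroupRep.{u, u, u} K),
        f.α = LinearMap.id ∧ Function.Surjective f.β}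

end GroupRep

/-!
Each of the five operators preserves action type quasi-identities. For `𝒮` and `𝒞` this is clear;
for `𝒬⁰` and `𝒬ʳ` it holds because an equality `w = 0` is a statement about the module alone and
homomorphisms out of a free representation lift through epimorphisms
(`GroupRep.Satisfies.of_surjective`); for ultraproducts it is the easy half of the theorem of Łoś
(`GroupRep.Satisfies.filteredProduct`).

Conversely, let `R = (V, G)` belong to the quasi-variety of `𝔛`, and let `π : W(V, G) → R` be the
canonical epimorphism. A finite part of the kernel of `π`, together with an element `w₀` outside the
kernel, involves finitely many variables and so gives a quasi-identity that fails in `R`, hence in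
some member of `𝔛` (`GroupRep.exists_hom_of_finite`). An ultraproduct over the finite parts of the
kernel yields a homomorphism from `W(V, G)` to a member of `𝒞_up 𝔛` that kills the whole kernel but
not `w₀` (`GroupRep.exists_hom_opCup`), and the product over all `w₀` yields a homomorphism `f` to a
member of `𝒞 𝒞_up 𝔛` with the same kernel on modules as `π` (`GroupRep.exists_hom_opC_opCup`). The
image of `f` is therefore a representation on `V` of a group `D` that acts through the same
transformations as `G`, and the operators `𝒬ʳ` and `𝒬⁰` replace `D` first by the group of these
transformations and then by `G` (`GroupRep.mem_opQ0_opQr_opS`). On the group side `f` and `π` need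
not have comparable kernels, which is why both operators are required.
-/

universe v₁ w₁ v₂ w₂ v₃ w₃

namespace GroupRep

variable {K : Type u} [CommRing K]

/-! ### Homomorphisms -/

/-- Composition of homomorphisms of representations. -/
def Hom.comp {R : GroupRep.{u, v₁, w₁} K} {S : GroupRep.{u, v₂, w₂} K}
    {T : GroupRep.{u, v₃, w₃} K} (g : Hom S T) (f : Hom R S) : Hom R T where
  α := g.α ∘ₗ f.α
  β := g.β.comp f.β
  map_act x h := by simp [f.map_act, g.map_act]

/-! ### Free representations -/

section Free

variable {X : Type v} {Y : Type w}

/-- The element `x ∘ g` of the free representation, for a basis element `x` and a word `g`. -/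
noncomputable def gen (K : Type u) [CommRing K] {X : Type v} {Y : Type w} (x : X)
    (g : (free K X Y).G) : (free K X Y).V :=
  (Finsupp.single x (MonoidAlgebra.of K (FreeGroup Y) g) : X →₀ MonoidAlgebra K (FreeGroup Y))

/-- The element of the group of the free representation given by a group variable. -/
def letter (K : Type u) [CommRing K] (X : Type v) {Y : Type w} (y : Y) : (free K X Y).G :=
  FreeGroup.of y

theorem act_gen (x : X) (g h : (free K X Y).G) :
    (free K X Y).act (gen K x g) h = gen K x (g * h) := by
  change Finsupp.mapRange (fun r => r * MonoidAlgebra.of K (FreeGroup Y) h) (zero_mul _)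
    (Finsupp.single x (MonoidAlgebra.of K (FreeGroup Y) g)) = _
  rw [Finsupp.mapRange_single]
  exact congrArg (Finsupp.single x) (map_mul (MonoidAlgebra.of K (FreeGroup Y)) g h).symm

theorem free_submodule_eq_top (W : Submodule K (free K X Y).V)
    (h : ∀ x g, gen K x g ∈ W) : W = ⊤ := by
  rw [eq_top_iff]
  rintro a -
  refine Finsupp.induction_linear (motive := fun a : X →₀ MonoidAlgebra K (FreeGroup Y) =>
    (show (free K X Y).V from a) ∈ W) a W.zero_mem (fun a b ha hb => W.add_mem ha hb) ?_
  intro x r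
  refine MonoidAlgebra.induction_linear (motive := fun r =>
    (show (free K X Y).V from (Finsupp.single x r : X →₀ MonoidAlgebra K (FreeGroup Y))) ∈ W)
    r ?_ ?_ ?_
  · rw [Finsupp.single_zero]
    exact W.zero_mem
  · intro r s hr hs
    rw [Finsupp.single_add]
    exact W.add_mem hr hs
  · intro g k
    have := W.smul_mem k (h x g)
    rw [← MonoidAlgebra.smul_of, ← Finsupp.smul_single]
    exact this

theorem free_linearMap_ext {M : Type*} [AddCommGroup M] [Module K M]
    {f f' : (free K X Y).V →ₗ[K] M} (h : ∀ x g, f (gen K x g) = f' (gen K x g)) : f = f' :=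
  LinearMap.eqLocus_eq_top.1 (free_submodule_eq_top (LinearMap.eqLocus f f') h)

theorem free_monoidHom_ext {M : Type*} [Group M] {f f' : (free K X Y).G →* M}
    (h : ∀ y, f (letter K X y) = f' (letter K X y)) : f = f' :=
  FreeGroup.ext_hom (f : FreeGroup Y →* M) f' h

variable {S : GroupRep.{u, v', w'} K}

theorem Hom.map_gen (f : Hom (free K X Y) S) (x : X) (g : (free K X Y).G) :
    f.α (gen K x g) = S.act (f.α (gen K x 1)) (f.β g) := by
  rw [← f.map_act, act_gen, one_mul]

/-- The linear map `XKF(Y) → V` that sends `x ∘ g` to `a x ∘ b g`. -/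
noncomputable def freeLiftLinear (a : X → S.V) (b : (free K X Y).G →* S.G) :
    (free K X Y).V →ₗ[K] S.V :=
  Finsupp.lsum K fun x => (Finsupp.linearCombination K fun g => S.act (a x) (b g)) ∘ₗ
    (MonoidAlgebra.coeffLinearEquiv (S := K) (M := FreeGroup Y) K).toLinearMap

theorem freeLiftLinear_gen (a : X → S.V) (b : (free K X Y).G →* S.G) (x : X)
    (g : (free K X Y).G) : freeLiftLinear a b (gen K x g) = S.act (a x) (b g) := by
  refine (Finsupp.lsum_single _ _ _ _).trans ?_
  exact (Finsupp.linearCombination_single K (1 : K) g).trans (one_smul K _)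

/-- The universal property of the free representation: a homomorphism is given by arbitrary images
of the module variables and of the group variables. -/
noncomputable def freeLift (a : X → S.V) (b : Y → S.G) : Hom (free K X Y) S where
  α := freeLiftLinear a (FreeGroup.lift b)
  β := FreeGroup.lift b
  map_act x g := by
    let b' : (free K X Y).G →* S.G := FreeGroup.lift b
    have : freeLiftLinear a b' ∘ₗ (free K X Y).ρ (MulOpposite.op g) =
        S.ρ (MulOpposite.op (b' g)) ∘ₗ freeLiftLinear a b' := by
      refine free_linearMap_ext fun x h => ?_
      change freeLiftLinear a b' ((free K X Y).act (gen K x h) g) =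
        S.act (freeLiftLinear a b' (gen K x h)) (b' g)
      rw [act_gen, freeLiftLinear_gen, freeLiftLinear_gen, map_mul, act_mul]
    exact LinearMap.congr_fun this x

theorem freeLift_gen (a : X → S.V) (b : Y → S.G) (x : X) :
    (freeLift a b).α (gen K x 1) = a x := by
  refine (freeLiftLinear_gen a _ x 1).trans ?_
  exact (congrArg (S.act (a x)) (map_one (FreeGroup.lift b))).trans (S.act_one (a x))

theorem freeLift_letter (a : X → S.V) (b : Y → S.G) (y : Y) :
    (freeLift a b).β (letter K X y) = b y :=
  FreeGroup.lift_apply_of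

/-- Homomorphisms out of a free representation are determined by the images of the variables. -/
theorem Hom.free_ext {f f' : Hom (free K X Y) S}
    (hα : ∀ x, f.α (gen K x 1) = f'.α (gen K x 1))
    (hβ : ∀ y, f.β (letter K X y) = f'.β (letter K X y)) : f.α = f'.α ∧ f.β = f'.β := by
  have h := free_monoidHom_ext hβ
  exact ⟨free_linearMap_ext fun x g => by rw [f.map_gen, f'.map_gen, hα, h], h⟩

/-- Free representations are projective with respect to surjective homomorphisms. -/
theorem Hom.exists_free_lift {T : GroupRep.{u, v₁, w₁} K}
    {S : GroupRep.{u, v₂, w₂} K} (p : Hom T S)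
    (hα : Function.Surjective p.α) (hβ : Function.Surjective p.β) (f : Hom (free K X Y) S) :
    ∃ f' : Hom (free K X Y) T, (∀ w, p.α (f'.α w) = f.α w) ∧ ∀ g, p.β (f'.β g) = f.β g := by
  choose a ha using fun x => hα (f.α (gen K x 1))
  choose b hb using fun y => hβ (f.β (letter K X y))
  have h : (p.comp (freeLift a b)).α = f.α ∧ (p.comp (freeLift a b)).β = f.β := by
    refine Hom.free_ext (fun x => ?_) fun y => ?_
    · change p.α ((freeLift a b).α (gen K x 1)) = _
      rw [freeLift_gen, ha]
    · change p.β ((freeLift a b).β (letter K X y)) = _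
      rw [freeLift_letter, hb]
  exact ⟨freeLift a b, LinearMap.congr_fun h.1, DFunLike.congr_fun h.2⟩

/-- The homomorphism of free representations induced by maps of the variables. -/
noncomputable def freeMap {X : Type v₁} {Y : Type w₁} {X' : Type v₂} {Y' : Type w₂}
    (i : X → X') (j : Y → Y') : Hom (free K X Y) (free K X' Y') :=
  freeLift (fun x => gen K (i x) 1) fun y => letter K X' (j y)

theorem freeMap_gen_one {X' : Type v'} {Y' : Type w'} (i : X → X') (j : Y → Y') (x : X) :
    (freeMap i j).α (gen K x 1) = gen K (i x) 1 :=
  freeLift_gen _ _ x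

theorem freeMap_letter {X' : Type v'} {Y' : Type w'} (i : X → X') (j : Y → Y') (y : Y) :
    (freeMap i j).β (letter K X y) = letter K X' (j y) :=
  freeLift_letter _ _ y

theorem freeMap_comp {X₁ : Type v₁} {Y₁ : Type w₁} {X₂ : Type v₂} {Y₂ : Type w₂}
    {X₃ : Type v₃} {Y₃ : Type w₃} (i' : X₂ → X₃) (j' : Y₂ → Y₃) (i : X₁ → X₂) (j : Y₁ → Y₂) :
    (∀ w, (freeMap (K := K) i' j').α ((freeMap i j).α w) = (freeMap (i' ∘ i) (j' ∘ j)).α w) ∧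
      ∀ g, (freeMap (K := K) i' j').β ((freeMap i j).β g) = (freeMap (i' ∘ i) (j' ∘ j)).β g := by
  have h := Hom.free_ext (f := (freeMap (K := K) i' j').comp (freeMap i j))
    (f' := freeMap (i' ∘ i) (j' ∘ j))
    (fun x => by
      change (freeMap i' j').α ((freeMap i j).α (gen K x 1)) = _
      rw [freeMap_gen_one, freeMap_gen_one, freeMap_gen_one, Function.comp_apply])
    (fun y => by
      change (freeMap i' j').β ((freeMap i j).β (letter K X₁ y)) = _
      rw [freeMap_letter, freeMap_letter, freeMap_letter, Function.comp_apply])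
  exact ⟨LinearMap.congr_fun h.1, DFunLike.congr_fun h.2⟩

end Free

/-! ### The operators preserve action type quasi-identities -/

theorem Satisfies.of_jointly_injective {R : GroupRep.{u, v₁, w₁} K}
    {I : Type*} {P : I → GroupRep.{u, v₂, w₂} K} {q : ActionQuasiIdentity K}
    (p : ∀ i, Hom R (P i)) (hp : ∀ x, (∀ i, (p i).α x = 0) → x = 0)
    (h : ∀ i, (P i).Satisfies q) : R.Satisfies q := fun f hf =>
  hp _ fun i => h i ((p i).comp f) fun j => by
    change (p i).α (f.α (q.premise j)) = 0
    rw [hf, map_zero]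

theorem Satisfies.of_injective {R : GroupRep.{u, v₁, w₁} K}
    {S : GroupRep.{u, v₂, w₂} K} {q : ActionQuasiIdentity K}
    (h : S.Satisfies q) (p : Hom R S) (hp : Function.Injective p.α) : R.Satisfies q :=
  .of_jointly_injective (I := Unit) (fun _ => p)
    (fun _ hx => (map_eq_zero_iff p.α hp).1 (hx ())) fun _ => h

/-- A quasi-identity passes along `p` whenever `p` is bijective on modules and surjective on groups,
since homomorphisms out of free representations lift through `p`. -/
theorem Satisfies.of_surjective {R : GroupRep.{u, v₁, w₁} K}
    {S : GroupRep.{u, v₂, w₂} K} {q : ActionQuasiIdentity K}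
    (h : R.Satisfies q) (p : Hom R S) (hα : Function.Bijective p.α)
    (hβ : Function.Surjective p.β) : S.Satisfies q := by
  intro f hf
  obtain ⟨f', h1, -⟩ := p.exists_free_lift hα.2 hβ f
  have h2 : f'.α q.conclusion = 0 := h f' fun i => hα.1 (by rw [h1, hf, map_zero])
  rw [← h1, h2, map_zero]

/-- The inclusion of a subrepresentation. -/
def Subrep.incl {R : GroupRep.{u, v, w} K} (P : Subrep R) : Hom P.toGroupRep R where
  α := P.V₀.subtype
  β := P.G₀.subtype
  map_act _ _ := rfl

section Products

variable {I : Type u} (P : I → GroupRep.{u, v, w} K)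

/-- The projection of a Cartesian product onto a factor. -/
def projHom (i : I) : Hom (cartesianProduct P) (P i) where
  α := LinearMap.proj (φ := fun i => (P i).V) i
  β := Pi.evalMonoidHom (fun i => (P i).G) i
  map_act _ _ := rfl

/-- The homomorphism into a Cartesian product with given components. -/
def pairHom {R : GroupRep.{u, v', w'} K} (f : ∀ i, Hom R (P i)) :
    Hom R (cartesianProduct P) where
  α := LinearMap.pi (φ := fun i => (P i).V) fun i => (f i).α
  β := MonoidHom.pi (f := fun i => (P i).G) fun i => (f i).β
  map_act x g := funext fun i => (f i).map_act x g

/-- The projection of a Cartesian product onto a filtered product. -/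
def filteredHom (F : Filter I) : Hom (cartesianProduct P) (filteredProduct F P) where
  α := (filterSubmodule F P).mkQ
  β := QuotientGroup.mk' (filterSubgroup F P)
  map_act _ _ := rfl

theorem filteredHom_α_eq_zero_iff (F : Filter I) (x : (cartesianProduct P).V) :
    (filteredHom P F).α x = 0 ↔ ∀ᶠ i in F, (projHom P i).α x = 0 :=
  Submodule.Quotient.mk_eq_zero (filterSubmodule F P)

/-- The easy half of the theorem of Łoś: a quasi-identity has only finitely many premises, so they
hold simultaneously on a set of the filter as soon as each of them holds on one. -/
theorem Satisfies.filteredProduct {P} {q : ActionQuasiIdentity K} (F : Filter I)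
    (h : ∀ i, (P i).Satisfies q) : (filteredProduct F P).Satisfies q := by
  intro f hf
  obtain ⟨f', h1, -⟩ := (filteredHom P F).exists_free_lift
    (Submodule.mkQ_surjective (filterSubmodule F P))
    (QuotientGroup.mk'_surjective (filterSubgroup F P)) f
  rw [← h1, filteredHom_α_eq_zero_iff]
  have : ∀ᶠ i in F, ∀ j, (projHom P i).α (f'.α (q.premise j)) = 0 := by
    rw [Filter.eventually_all]
    intro j
    rw [← filteredHom_α_eq_zero_iff, h1, hf]
  filter_upwards [this] with i hi
  exact h i ((projHom P i).comp f') hi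

end Products

theorem subset_qVarAT_iff_qIdAT {𝔛 𝔜 : Set (GroupRep.{u, u, u} K)} :
    𝔜 ⊆ qVarAT 𝔛 ↔ qIdAT 𝔛 ⊆ qIdAT 𝔜 :=
  ⟨fun h q hq _ hR => h hR q hq, fun h R hR _ hq => h hq R hR⟩

section Operators

variable (𝔛 : Set (GroupRep.{u, u, u} K))

theorem qIdAT_subset_opS : qIdAT 𝔛 ⊆ qIdAT (opS 𝔛) := by
  rintro q hq R ⟨P, hP, P₀, f, hf, -⟩
  exact (hq P hP).of_injective (P₀.incl.comp f) (P₀.V₀.subtype_injective.comp hf.1)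

theorem qIdAT_subset_opC : qIdAT 𝔛 ⊆ qIdAT (opC 𝔛) := by
  rintro q hq R ⟨I, P, hP, f, hf, -⟩
  exact (Satisfies.of_jointly_injective (projHom P) (fun _ hx => funext hx)
    fun i => hq _ (hP i)).of_injective f hf.1

theorem qIdAT_subset_opCup : qIdAT 𝔛 ⊆ qIdAT (opCup 𝔛) := by
  rintro q hq R ⟨I, U, P, hP, f, hf, -⟩
  have h : (filteredProduct (U : Filter I) P).Satisfies q :=
    Satisfies.filteredProduct (U : Filter I) fun i => hq _ (hP i)
  exact h.of_injective f hf.1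

theorem qIdAT_subset_opQr : qIdAT 𝔛 ⊆ qIdAT (opQr 𝔛) := by
  rintro q hq R ⟨D, _, τ, hD, f, hf, hs⟩
  have hb : Function.Bijective f.α := by
    rw [hf]
    exact Function.bijective_id
  exact (hq _ hD).of_surjective f hb hs

theorem qIdAT_subset_opQ0 : qIdAT 𝔛 ⊆ qIdAT (opQ0 𝔛) := by
  rintro q hq R ⟨D, _, τ, hD, f, hf, -⟩
  have hi : Function.Injective f.α := by
    rw [hf]
    exact Function.injective_id
  exact (hq _ hD).of_injective f hi

end Operators

/-! ### Finitely many elements involve finitely many variables -/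

section FiniteVariables

variable {X : Type v} {Y : Type w}

theorem freeMap_gen {X' : Type v'} {Y' : Type w'} (i : X → X') (j : Y → Y') (x : X)
    (g : (free K X Y).G) :
    (freeMap i j).α (gen K x g) = gen K (i x) ((freeMap (X := X) (X' := X') i j).β g) := by
  rw [Hom.map_gen, freeMap_gen_one, act_gen, one_mul]

/-- The elements of `XKF(Y)` that involve only variables from `s` and `t`. -/
noncomputable def freeRange (K : Type u) [CommRing K] (s : Finset X) (t : Finset Y) :
    Submodule K (free K X Y).V :=
  LinearMap.range (freeMap (K := K) (Subtype.val : s → X) (Subtype.val : t → Y)).α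

/-- The elements of `F(Y)` that involve only variables from `t`. -/
noncomputable def freeRangeGroup (K : Type u) [CommRing K] (s : Finset X) (t : Finset Y) :
    Subgroup (free K X Y).G :=
  (freeMap (K := K) (Subtype.val : s → X) (Subtype.val : t → Y)).β.range

theorem freeRange_mono {s s' : Finset X} {t t' : Finset Y} (hs : s ⊆ s') (ht : t ⊆ t') :
    freeRange K s t ≤ freeRange K s' t' ∧ freeRangeGroup K s t ≤ freeRangeGroup K s' t' := by
  let k : Hom (free K s t) (free K s' t') :=
    freeMap (fun x : s => (⟨x, hs x.2⟩ : s')) (fun y : t => (⟨y, ht y.2⟩ : t'))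
  have h := freeMap_comp (K := K) (Subtype.val : s' → X) (Subtype.val : t' → Y)
    (fun x : s => (⟨x, hs x.2⟩ : s')) (fun y : t => (⟨y, ht y.2⟩ : t'))
  constructor
  · rintro _ ⟨w, rfl⟩
    exact ⟨k.α w, h.1 w⟩
  · rintro _ ⟨g, rfl⟩
    exact ⟨k.β g, h.2 g⟩

theorem exists_mem_freeRangeGroup (s : Finset X) (g : (free K X Y).G) :
    ∃ t : Finset Y, g ∈ freeRangeGroup K s t := by
  classical
  have hd : Directed (· ≤ ·) fun t : Finset Y => freeRangeGroup K s t := fun t t' =>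
    ⟨t ∪ t', (freeRange_mono subset_rfl Finset.subset_union_left).2,
      (freeRange_mono subset_rfl Finset.subset_union_right).2⟩
  rw [← Subgroup.mem_iSup_of_directed hd]
  have h : Subgroup.closure (Set.range (letter K X (Y := Y))) ≤
      ⨆ t : Finset Y, freeRangeGroup K s t := by
    rw [Subgroup.closure_le]
    rintro _ ⟨y, rfl⟩
    exact Subgroup.mem_iSup_of_mem {y}
      ⟨letter K s ⟨y, Finset.mem_singleton_self y⟩, freeLift_letter _ _ _⟩
  exact h ((FreeGroup.closure_range_of Y).ge (Subgroup.mem_top g))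

theorem directed_freeRange :
    Directed (· ≤ ·) fun p : Finset X × Finset Y => freeRange K p.1 p.2 := by
  classical
  exact fun p p' =>
    ⟨(p.1 ∪ p'.1, p.2 ∪ p'.2),
      (freeRange_mono Finset.subset_union_left Finset.subset_union_left).1,
      (freeRange_mono Finset.subset_union_right Finset.subset_union_right).1⟩

theorem iSup_freeRange :
    ⨆ p : Finset X × Finset Y, freeRange K p.1 p.2 = ⊤ := by
  refine free_submodule_eq_top _ fun x g => ?_
  obtain ⟨t, g', hg'⟩ := exists_mem_freeRangeGroup {x} g
  refine Submodule.mem_iSup_of_mem (({x}, t) : Finset X × Finset Y)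
    ⟨gen K ⟨x, Finset.mem_singleton_self x⟩ g', ?_⟩
  rw [freeMap_gen, hg']

theorem exists_subset_freeRange {T : Set (free K X Y).V} (hT : T.Finite) :
    ∃ (s : Finset X) (t : Finset Y), T ⊆ freeRange K s t := by
  have h (w : (free K X Y).V) : ∃ p : Finset X × Finset Y, w ∈ freeRange K p.1 p.2 := by
    rw [← Submodule.mem_iSup_of_directed _ directed_freeRange, iSup_freeRange]
    trivial
  classical
  choose p hp using h
  obtain ⟨q, hq⟩ := (directed_freeRange (K := K) (X := X) (Y := Y)).finset_le
    (hT.toFinset.image p)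
  exact ⟨q.1, q.2, fun w hw => hq (p w) (by simpa using ⟨w, hw, rfl⟩) (hp w)⟩

/-- Finitely many elements of a free representation, on variables of any kind, come from a free
representation on variables taken from the countable stocks. -/
theorem exists_relabelling {T : Set (free K X Y).V} (hT : T.Finite) :
    ∃ (X₀ Y₀ : Finset ℕ) (i : X₀ → X) (j : Y₀ → Y), Function.Injective i ∧ Function.Injective j ∧
      ∀ w ∈ T, ∃ w', (freeMap i j).α w' = w := by
  obtain ⟨s, t, hst⟩ := exists_subset_freeRange hT
  let e : Finset.range s.card ≃ s := Fintype.equivOfCardEq (by simp)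
  let e' : Finset.range t.card ≃ t := Fintype.equivOfCardEq (by simp)
  refine ⟨_, _, fun x => e x, fun y => e' y, Subtype.val_injective.comp e.injective,
    Subtype.val_injective.comp e'.injective, fun w hw => ?_⟩
  obtain ⟨w', rfl⟩ := hst hw
  refine ⟨(freeMap e.symm e'.symm).α w', ?_⟩
  rw [(freeMap_comp _ _ _ _).1]
  congr 3
  · funext x
    simp
  · funext y
    simp

end FiniteVariables

/-! ### Compactness -/

section Compactness

variable {𝔛 : Set (GroupRep.{u, u, u} K)} {R : GroupRep.{u, u, u} K}

/-- If finitely many elements of a free representation are killed by a homomorphism to a member of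
the quasi-variety that does not kill `w₀`, then the same happens for some member of `𝔛`: the
quasi-identity with these elements as premises and conclusion `w₀` must fail in `𝔛`. -/
theorem exists_hom_of_finite {X : Type v} {Y : Type w} (hR : R ∈ qVarAT 𝔛)
    (π : Hom (free K X Y) R) (T : Finset (free K X Y).V) (hT : ∀ w ∈ T, π.α w = 0)
    {w₀ : (free K X Y).V} (h₀ : π.α w₀ ≠ 0) :
    ∃ P ∈ 𝔛, ∃ f : Hom (free K X Y) P, (∀ w ∈ T, f.α w = 0) ∧ f.α w₀ ≠ 0 := by
  obtain ⟨X₀, Y₀, i, j, hi, hj, hm⟩ :=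
    exists_relabelling (K := K) ((T.finite_toSet).insert w₀)
  choose! r hr using hm
  let q : ActionQuasiIdentity K :=
    { X := X₀
      Y := Y₀
      n := T.card
      premise := fun k => r (T.equivFin.symm k)
      conclusion := r w₀ }
  have hq : q ∉ qIdAT 𝔛 := fun hq => by
    refine h₀ ?_
    rw [← hr w₀ (Set.mem_insert _ _)]
    refine hR q hq (π.comp (freeMap i j)) fun k => ?_
    have hk := (T.equivFin.symm k).2
    change π.α ((freeMap i j).α (r (T.equivFin.symm k))) = 0
    rw [hr _ (Set.mem_insert_of_mem _ hk)]
    exact hT _ hk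
  simp only [qIdAT, Set.mem_ofPred_eq, not_forall, exists_prop, Satisfies] at hq
  obtain ⟨P, hP, f₀, hf₀, hc⟩ := hq
  -- The variables outside the images of `i` and `j` may be sent anywhere.
  let f : Hom (free K X Y) P :=
    freeLift (Function.extend i (fun x => f₀.α (gen K x 1)) 0)
      (Function.extend j (fun y => f₀.β (letter K X₀ y)) 1)
  have h := (Hom.free_ext (f := f.comp (freeMap i j)) (f' := f₀)
    (fun x => by
      change f.α ((freeMap i j).α (gen K x 1)) = _
      rw [freeMap_gen_one]
      exact (freeLift_gen _ _ _).trans (hi.extend_apply _ _ _))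
    (fun y => by
      change f.β ((freeMap i j).β (letter K X₀ y)) = _
      rw [freeMap_letter]
      exact (freeLift_letter _ _ _).trans (hj.extend_apply _ _ _))).1
  have hfr (w) (hw : w ∈ insert w₀ (T : Set (free K X Y).V)) : f.α w = f₀.α (r w) :=
    (congrArg f.α (hr w hw)).symm.trans (LinearMap.congr_fun h (r w))
  refine ⟨P, hP, f, fun w hw => ?_, ?_⟩
  · rw [hfr w (Set.mem_insert_of_mem _ hw)]
    simpa [q] using hf₀ (T.equivFin ⟨w, hw⟩)
  · rw [hfr w₀ (Set.mem_insert _ _)]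
    exact hc

variable {X Y : Type u}

/-- The compactness argument: an ultraproduct over the finite sets of elements of the kernel
of `π` satisfies all conditions of the kernel at once. -/
theorem exists_hom_opCup (hR : R ∈ qVarAT 𝔛) (π : Hom (free K X Y) R) {w₀ : (free K X Y).V}
    (h₀ : π.α w₀ ≠ 0) :
    ∃ P ∈ opCup 𝔛, ∃ f : Hom (free K X Y) P, (∀ w, π.α w = 0 → f.α w = 0) ∧ f.α w₀ ≠ 0 := by
  classical
  let N := {w : (free K X Y).V // π.α w = 0}
  have hex (Φ : Finset N) : ∃ P ∈ 𝔛, ∃ f : Hom (free K X Y) P,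
      (∀ w ∈ Φ, f.α w = 0) ∧ f.α w₀ ≠ 0 := by
    obtain ⟨P, hP, f, hf, hf₀⟩ := exists_hom_of_finite hR π (Φ.image Subtype.val)
      (by simp +contextual [N]) h₀
    exact ⟨P, hP, f, fun w hw => hf w (Finset.mem_image_of_mem _ hw), hf₀⟩
  choose P hP f hf hf₀ using hex
  let U : Ultrafilter (Finset N) := Ultrafilter.of Filter.atTop
  refine ⟨filteredProduct (U : Filter (Finset N)) P,
    ⟨Finset N, U, P, hP, ⟨⟨LinearMap.id, MonoidHom.id _, fun _ _ => rfl⟩,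
      Function.bijective_id, Function.bijective_id⟩⟩,
    (filteredHom P U).comp (pairHom P f), fun w hw => ?_, fun h => ?_⟩
  · refine (filteredHom_α_eq_zero_iff P U _).2 (Ultrafilter.of_le Filter.atTop ?_)
    filter_upwards [Filter.eventually_ge_atTop {(⟨w, hw⟩ : N)}] with Φ hΦ
    exact hf Φ ⟨w, hw⟩ (Finset.singleton_subset_iff.1 hΦ)
  · obtain ⟨Φ, hΦ⟩ := ((filteredHom_α_eq_zero_iff P U _).1 h).exists
    exact hf₀ Φ hΦ

/-- In a product of ultraproducts of members of `𝔛` the kernel of `π` is realized exactly. -/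
theorem exists_hom_opC_opCup (hR : R ∈ qVarAT 𝔛) (π : Hom (free K X Y) R) :
    ∃ P ∈ opC (opCup 𝔛), ∃ f : Hom (free K X Y) P,
      LinearMap.ker π.α = LinearMap.ker f.α := by
  choose P hP f hf hf₀ using
    fun w : {w : (free K X Y).V // π.α w ≠ 0} => exists_hom_opCup hR π w.2
  refine ⟨cartesianProduct P, ⟨_, P, hP, ⟨⟨LinearMap.id, MonoidHom.id _, fun _ _ => rfl⟩,
      Function.bijective_id, Function.bijective_id⟩⟩, pairHom P f, ?_⟩
  refine le_antisymm (fun w hw => funext fun w₀ => hf w₀ w hw) fun w hw => ?_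
  by_contra h
  exact hf₀ ⟨w, h⟩ (congrFun hw ⟨w, h⟩)

end Compactness

/-! ### Change of the acting group -/

/-- A representation of `G` on `V` is obtained by `𝒬ʳ` and `𝒬⁰` from any representation on `V` of a
group `D` that acts through the same set of transformations: `D` and `G` both map onto the group of
these transformations. -/
theorem mem_opQ0_opQr {𝔜 : Set (GroupRep.{u, u, u} K)} {R : GroupRep.{u, u, u} K} {D : Type u}
    [Group D] (τ : Representation K Dᵐᵒᵖ R.V) (hD : (⟨R.V, D, τ⟩ : GroupRep.{u, u, u} K) ∈ 𝔜)
    (h₁ : ∀ d, ∃ g, R.ρ g = τ d) (h₂ : ∀ g, ∃ d, τ d = R.ρ g) : R ∈ opQ0 (opQr 𝔜) := by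
  let T : Subgroup (Module.End K R.V)ˣ := R.ρ.toHomUnits.range
  let σ : Representation K (Tᵐᵒᵖ)ᵐᵒᵖ R.V :=
    { toFun := fun t => (t.unop.unop : (Module.End K R.V)ˣ)
      map_one' := rfl
      map_mul' := fun _ _ => rfl }
  let φ : R.G →* Tᵐᵒᵖ :=
    { toFun := fun g => .op ⟨R.ρ.toHomUnits (.op g), ⟨_, rfl⟩⟩
      map_one' := MulOpposite.unop_injective (Subtype.ext (map_one R.ρ.toHomUnits))
      map_mul' := fun g h => MulOpposite.unop_injective
        (Subtype.ext (R.ρ.toHomUnits.map_mul (.op h) (.op g))) }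
  have hmem (d : Dᵐᵒᵖ) : τ.toHomUnits d ∈ T := by
    obtain ⟨g, hg⟩ := h₁ d
    exact ⟨g, Units.ext hg⟩
  let ψ : D →* Tᵐᵒᵖ :=
    { toFun := fun d => .op ⟨τ.toHomUnits (.op d), hmem _⟩
      map_one' := MulOpposite.unop_injective (Subtype.ext (map_one τ.toHomUnits))
      map_mul' := fun g h => MulOpposite.unop_injective
        (Subtype.ext (τ.toHomUnits.map_mul (.op h) (.op g))) }
  refine ⟨Tᵐᵒᵖ, inferInstance, σ,
    ⟨D, inferInstance, τ, hD, ⟨LinearMap.id, ψ, fun _ _ => rfl⟩, rfl, ?_⟩,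
    ⟨LinearMap.id, φ, fun _ _ => rfl⟩, rfl, ?_⟩
  · rintro ⟨⟨_, g, rfl⟩⟩
    obtain ⟨d, hd⟩ := h₂ g
    exact ⟨d.unop, MulOpposite.unop_injective (Subtype.ext (Units.ext hd))⟩
  · rintro ⟨⟨_, g, rfl⟩⟩
    exact ⟨g.unop, rfl⟩

/-- If `π : F → R` is surjective and `f : F → P` has the same kernel on modules, then `R` arises
from the image of `f`, a subrepresentation of `P`, by change of the acting group. -/
theorem mem_opQ0_opQr_opS {𝔜 : Set (GroupRep.{u, u, u} K)} {F : GroupRep.{u, v, w} K}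
    {R P : GroupRep.{u, u, u} K} (hP : P ∈ 𝔜) (π : Hom F R) (hα : Function.Surjective π.α)
    (hβ : Function.Surjective π.β) (f : Hom F P) (h : LinearMap.ker π.α = LinearMap.ker f.α) :
    R ∈ opQ0 (opQr (opS 𝔜)) := by
  let P₀ : Subrep P :=
    { V₀ := LinearMap.range f.α
      G₀ := f.β.range
      act_mem := by
        rintro _ ⟨x, rfl⟩ _ ⟨g, rfl⟩
        exact ⟨F.act x g, f.map_act x g⟩ }
  let e : R.V ≃ₗ[K] LinearMap.range f.α :=
    (π.α.quotKerEquivOfSurjective hα).symm ≪≫ₗ Submodule.quotEquivOfEq _ _ h ≪≫ₗ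
      f.α.quotKerEquivRange
  have he (w : F.V) : (e (π.α w) : P.V) = f.α w := by
    have : (π.α.quotKerEquivOfSurjective hα).symm (π.α w) = Submodule.Quotient.mk w := by
      rw [LinearEquiv.symm_apply_eq]
      rfl
    simp only [e, LinearEquiv.trans_apply, this]
    rfl
  -- The same equivalence, with its codomain regarded as the module of the subrepresentation.
  let e₀ : R.V ≃ₗ[K] P₀.toGroupRep.V := e
  -- The action of the image of `f` on its module, transported to `R.V`.
  let τ : Representation K (f.β.range)ᵐᵒᵖ R.V :=
    { toFun := fun d => e₀.symm.toLinearMap ∘ₗ P₀.toGroupRep.ρ d ∘ₗ e₀.toLinearMap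
      map_one' := LinearMap.ext fun x => by
        have := P₀.toGroupRep.act_one (e₀ x)
        exact (congrArg e₀.symm this).trans (e₀.symm_apply_apply x)
      map_mul' := fun c d => LinearMap.ext fun x => by
        refine congrArg e₀.symm ((P₀.toGroupRep.act_mul (e₀ x) d.unop c.unop).trans ?_)
        exact congrArg (P₀.toGroupRep.act · c.unop) (e₀.apply_symm_apply _).symm }
  have hτ (g : F.G) : R.ρ (.op (π.β g)) = τ (.op ⟨f.β g, g, rfl⟩) := by
    refine LinearMap.ext fun x => e₀.injective ?_
    obtain ⟨w, rfl⟩ := hα x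
    refine Eq.trans (Subtype.ext ?_) (e₀.apply_symm_apply _).symm
    change (e (R.act (π.α w) (π.β g)) : P.V) = P.act (e (π.α w)) (f.β g)
    rw [← π.map_act, he, he, f.map_act]
  refine mem_opQ0_opQr τ ⟨P, hP, P₀, ⟨⟨e₀.toLinearMap, MonoidHom.id _, fun x d => ?_⟩,
    e₀.bijective, Function.bijective_id⟩⟩ ?_ ?_
  · exact e₀.apply_symm_apply _
  · rintro ⟨⟨_, g, rfl⟩⟩
    exact ⟨_, hτ g⟩
  · rintro ⟨g⟩
    obtain ⟨g', rfl⟩ := hβ g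
    exact ⟨_, (hτ g').symm⟩

end GroupRep

theorem corollary2 {K : Type u} [CommRing K] (𝔛 : Set (GroupRep.{u, u, u} K)) :
    GroupRep.qVarAT 𝔛 =
      GroupRep.opQ0 (GroupRep.opQr (GroupRep.opS (GroupRep.opC (GroupRep.opCup 𝔛)))) := by
  open GroupRep in
  refine Set.Subset.antisymm (fun R hR => ?_) (subset_qVarAT_iff_qIdAT.2 ?_)
  · let π : Hom (free K R.V R.G) R := freeLift id id
    obtain ⟨P, hP, f, hf⟩ := exists_hom_opC_opCup hR π
    exact mem_opQ0_opQr_opS hP π (fun x => ⟨gen K x 1, freeLift_gen _ _ x⟩)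
      (fun g => ⟨letter K R.V g, freeLift_letter _ _ g⟩) f hf
  · exact ((((qIdAT_subset_opCup 𝔛).trans (qIdAT_subset_opC _)).trans
      (qIdAT_subset_opS _)).trans (qIdAT_subset_opQr _)).trans (qIdAT_subset_opQ0 _)
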